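/- **Theorem (Uniqueness under connected support).** Let $X$ be a smooth manifold (without boundary, Hausdorff, second countable, finite-dimensional) and $Y$ a Polish space, let $\mu$ and $\nu$ be Borel probability measures on $X$ and $Y$, and let $c\colon X\times Y\to[0,\infty)$ be continuous. Assume that $c(\cdot,y)$ is locally Lipschitz locally uniformly in $y$: for every compact $K\subset Y$ and every chart $\varphi$ of $X$, each point of $\mathrm{range}\,\varphi$ has a neighbourhood $V\subset\mathrm{range}\,\varphi$ on which the functions $c(\varphi^{-1}(\cdot),y)$, $y\in K$, are Lipschitz with a common constant. Let $\mathcal C(\mu,\nu)$ be the set of couplings of $\mu$ and $\nu$, assume that $T_c(\mu,\nu)=\inf_{\pi\in\mathcal C(\mu,\nu)}\int c\,\mathrm d\pi<\infty$, and let $\pi\in\mathcal C(\mu,\nu)$ be optimal, i.e. $\int c\,\mathrm d\pi=T_c(\mu,\nu)$. We say that $\pi$ induces regularity at $x\in\mathrm{supp}\,\mu$ if there are a relatively open neighbourhood $U\subset\mathrm{supp}\,\mu$ of $x$ and a compact set $K\subset Y$ with $$\mathrm{pr}_X(\mathrm{supp}\,\pi)\cap U=\mathrm{pr}_X\big(\mathrm{supp}\,\pi\cap(U\times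 K)\big).$$ Put $$\Sigma=\{x\in\mathrm{supp}\,\mu : \pi\text{ does not induce regularity at }x\},\qquad \Gamma=\{(x,y)\in\mathrm{supp}\,\pi : c(\cdot,y)\text{ is differentiable at }x\}.$$ Assume that 1. $\mu(\mathrm{supp}\,\mu\setminus\Sigma)=1$; 2. $M=\mathrm{int}(\mathrm{supp}\,\mu\setminus\Sigma)$ is connected and $\mathrm{cl}(M)=\mathrm{supp}\,\mu$; 3. $\mathrm{pr}_X(\Gamma)$ has full Lebesgue measure in charts of $M$, i.e. $\varphi(M\cap\mathrm{domain}\,\varphi)\setminus\varphi\big(\mathrm{pr}_X(\Gamma)\cap M\cap\mathrm{domain}\,\varphi\big)$ is a Lebesgue null set for every chart $\varphi$ of $X$. Then the Kantorovich potentials are almost surely unique up to constant shifts: for any two Kantorovich potentials $f_1,f_2$ there is $a\in\mathbb R$ with $f_1-f_2=a$ $\mu$-almost surely (in particular, both are finite $\mu$-almost surely). Here a Kantorovich potential is a function $f\colon X\to\mathbb R\cup\{-\infty\}$, not identically $-\infty$, of the form $f(x)=\inf_{y\in Y}\big(c(x,y)-g(y)\big)$ for some $g\colon Y\to\mathbb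 R\cup\{-\infty\}$, such that, with $f^c(y)=\inf_{x\in X}\big(c(x,y)-f(x)\big)$, $$T_c(\mu,\nu)=\int\big(f(x)+f^c(y)\big)\,\mathrm d\pi'(x,y)$$ for some optimal $\pi'\in\mathcal C(\mu,\nu)$. "Every chart" means every chart of a fixed smooth atlas of $X$. -/

import Mathlib

open MeasureTheory Set Topology
open scoped ENNReal ContDiff Manifold

namespace KantorovichPotentials

section Transport

variable {X Y : Type*}

/-- The `c`-transform `g^c(x) = inf_y (c(x, y) - g(y))` of a function `g` on `Y`. -/
noncomputable def cTransformY (c : X × Y → ℝ) (g : Y → EReal) (x : X) : EReal :=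
  ⨅ y, ((c (x, y) : EReal) - g y)

/-- The `c`-transform `f^c(y) = inf_x (c(x, y) - f(x))` of a function `f` on `X`. -/
noncomputable def cTransformX (c : X × Y → ℝ) (f : X → EReal) (y : Y) : EReal :=
  ⨅ x, ((c (x, y) : EReal) - f x)

/-- `f : X → ℝ ∪ {-∞}` is `c`-concave on `X`: it is the `c`-transform of some
`g : Y → ℝ ∪ {-∞}` and it is not identically `-∞`. -/
def IsCConcave (c : X × Y → ℝ) (f : X → EReal) : Prop :=
  (∀ x, f x ≠ ⊤) ∧ (∃ x, f x ≠ ⊥) ∧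
    ∃ g : Y → EReal, (∀ y, g y ≠ ⊤) ∧ f = cTransformY c g

/-- The integral, in the extended reals, of an extended real-valued function: the integral of
the positive part minus the integral of the negative part. -/
noncomputable def extIntegral {Z : Type*} [MeasurableSpace Z] (π : Measure Z) (h : Z → EReal) :
    EReal :=
  ((∫⁻ z, (h z).toENNReal ∂π : ℝ≥0∞) : EReal) - ((∫⁻ z, (-h z).toENNReal ∂π : ℝ≥0∞) : EReal)

variable [MeasurableSpace X] [MeasurableSpace Y]

/-- The transport plans between `μ` and `ν`. -/
def couplings (μ : Measure X) (ν : Measure Y) : Set (Measure (X × Y)) :=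
  {π | π.map Prod.fst = μ ∧ π.map Prod.snd = ν}

/-- The optimal transport cost `T_c(μ, ν)`, for a non-negative cost function `c`. -/
noncomputable def transportCost (c : X × Y → ℝ) (μ : Measure X) (ν : Measure Y) : ℝ≥0∞ :=
  ⨅ π ∈ couplings μ ν, ∫⁻ z, ENNReal.ofReal (c z) ∂π

/-- `π` is an optimal transport plan between `μ` and `ν`. -/
def IsOptimalPlan (c : X × Y → ℝ) (μ : Measure X) (ν : Measure Y) (π : Measure (X × Y)) : Prop :=
  π ∈ couplings μ ν ∧ ∫⁻ z, ENNReal.ofReal (c z) ∂π = transportCost c μ ν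

/-- `f` is a (generalized) Kantorovich potential: `f` is `c`-concave, and
`T_c(μ, ν) = π c = π (f ⊕ f^c)` for an optimal transport plan `π`. -/
def IsKantorovichPotential (c : X × Y → ℝ) (μ : Measure X) (ν : Measure Y) (f : X → EReal) :
    Prop :=
  IsCConcave c f ∧ ∃ π, IsOptimalPlan c μ ν π ∧
    extIntegral π (fun z => f z.1 + cTransformX c f z.2) = (transportCost c μ ν : EReal)

/-- Kantorovich potentials are almost surely unique, up to constant shifts: the difference of any
two of them is `μ`-almost surely equal to a (finite) constant. -/
def AlmostSurelyUniquePotentials (c : X × Y → ℝ) (μ : Measure X) (ν : Measure Y) : Prop :=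
  ∀ f₁ f₂ : X → EReal, IsKantorovichPotential c μ ν f₁ → IsKantorovichPotential c μ ν f₂ →
    ∃ a : ℝ, ∀ᵐ x ∂μ, f₁ x - f₂ x = (a : EReal)

variable [TopologicalSpace X] [TopologicalSpace Y]

/-- `π` induces regularity on `U`: there is a compact `K ⊆ Y` such that
`pr_X (supp π) ∩ U = pr_X (supp π ∩ (U × K))`. -/
def InducesRegularityOn (π : Measure (X × Y)) (U : Set X) : Prop :=
  ∃ K : Set Y, IsCompact K ∧
    Prod.fst '' π.support ∩ U = Prod.fst '' (π.support ∩ U ×ˢ K)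

/-- `π` induces regularity at `x`: it does so on a relatively open neighbourhood of `x` in
`supp μ`. -/
def InducesRegularityAt (μ : Measure X) (π : Measure (X × Y)) (x : X) : Prop :=
  ∃ O : Set X, IsOpen O ∧ x ∈ O ∩ μ.support ∧ InducesRegularityOn π (O ∩ μ.support)

/-- The set `Σ` of points of `supp μ` at which `π` does not induce regularity. -/
def irregularSet (μ : Measure X) (π : Measure (X × Y)) : Set X :=
  {x ∈ μ.support | ¬ InducesRegularityAt μ π x}

end Transport

section Manifold

/-- `c(·, y)` is locally Lipschitz, locally uniformly in `y`: for every compact `K ⊆ Y`, in every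
chart, each point has a neighbourhood on which all `c(·, y)` with `y ∈ K` are Lipschitz with one
common constant. -/
def LocallyLipschitzLocallyUniformly (d : ℕ) {X Y : Type*} [TopologicalSpace X]
    [ChartedSpace (EuclideanSpace ℝ (Fin d)) X] [TopologicalSpace Y] (c : X × Y → ℝ) : Prop :=
  ∀ K : Set Y, IsCompact K → ∀ φ ∈ atlas (EuclideanSpace ℝ (Fin d)) X, ∀ v ∈ φ.target,
    ∃ L : NNReal, ∃ V ∈ 𝓝 v, V ⊆ φ.target ∧
      ∀ y ∈ K, LipschitzOnWith L (fun w => c (φ.symm w, y)) V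

/-- `A` has full Lebesgue measure in charts of the open set `M`. The charts of `M` are the
restrictions to `M` of the charts of `X`. -/
def HasFullLebesgueMeasureInCharts (d : ℕ) {X : Type*} [TopologicalSpace X]
    [ChartedSpace (EuclideanSpace ℝ (Fin d)) X] (M A : Set X) : Prop :=
  ∀ φ ∈ atlas (EuclideanSpace ℝ (Fin d)) X,
    volume (φ '' (φ.source ∩ M) \ φ '' (A ∩ (φ.source ∩ M))) = 0

/-- The set `Γ` of those `(x, y) ∈ supp π` for which `c(·, y)` is differentiable at `x`. -/
def gradientSet (d : ℕ) {X Y : Type*} [TopologicalSpace X]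
    [ChartedSpace (EuclideanSpace ℝ (Fin d)) X] [TopologicalSpace Y]
    [MeasurableSpace X] [MeasurableSpace Y] (c : X × Y → ℝ) (π : Measure (X × Y)) :
    Set (X × Y) :=
  {z ∈ π.support | MDifferentiableAt (𝓡 d) 𝓘(ℝ, ℝ) (fun x => c (x, z.2)) z.1}

end Manifold

end KantorovichPotentials

/-! A potential `f` and its transform satisfy `f ⊕ f^c ≤ c`, with equality on the support of every
optimal plan, not only almost surely for the plan named in its definition
(`IsKantorovichPotential.add_eq_of_mem_support`). So `f` is touched from above by `c(·, y) - f^c(y)`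
at each `x` coupled with `y`.

Near a point of induced regularity the partners `y` can be taken in one compact set, so potentials
inherit the Lipschitz bound of `c` there (`exists_lipschitzOnWith_chart`). In a chart ball inside
`M`, Rademacher makes two potentials differentiable almost everywhere, and over `Γ` both derivatives
equal that of the same `c(·, y)`. The Lipschitz difference has zero derivative almost everywhere,
hence is locally constant. Connectedness makes it constant on `M`, continuity extends this to all
regular points, and these carry all the mass. -/

namespace KantorovichPotentials

open Filter

/-! ### Semicontinuity of infima and sums in the extended reals. -/

section Semicontinuity

variable {A B : Type*}

lemma upperSemicontinuous_iInf_coe_sub [TopologicalSpace A] {k : A → B → ℝ}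
    (hk : ∀ b, Continuous fun a => k a b) {g : B → EReal} (hg : ∀ b, g b ≠ ⊤) :
    UpperSemicontinuous fun a => ⨅ b, ((k a b : EReal) - g b) := by
  refine upperSemicontinuous_iInf fun b => ?_
  induction h : g b with
  | bot => simpa using upperSemicontinuous_const
  | top => exact absurd h (hg b)
  | coe r =>
    have : (fun a => (k a b : EReal) - (r : EReal)) = fun a => ((k a b - r : ℝ) : EReal) := by
      ext a; simp
    rw [this]
    exact (continuous_coe_real_ereal.comp ((hk b).sub continuous_const)).upperSemicontinuous

/-- Closedness is what lets an almost sure identity pass to the whole support. Excluding `⊤` makes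
extended addition continuous at the values involved. -/
lemma isClosed_le_add [TopologicalSpace A] [TopologicalSpace B] {f : A → EReal} {g : B → EReal}
    (hf : UpperSemicontinuous f) (hg : UpperSemicontinuous g) (hf' : ∀ a, f a ≠ ⊤)
    (hg' : ∀ b, g b ≠ ⊤) {c : A × B → ℝ} (hc : Continuous c) :
    IsClosed {z : A × B | (c z : EReal) ≤ f z.1 + g z.2} := by
  have h1 : UpperSemicontinuous fun z : A × B => f z.1 + g z.2 :=
    (hf.comp continuous_fst).add' (hg.comp continuous_snd) fun z =>
      EReal.continuousAt_add (Or.inl (hf' _)) (Or.inr (hg' _))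
  have h2 : UpperSemicontinuous fun z : A × B => (f z.1 + g z.2) + ((-c z : ℝ) : EReal) :=
    h1.add' (continuous_coe_real_ereal.comp hc.neg).upperSemicontinuous fun z =>
      EReal.continuousAt_add (Or.inr (EReal.coe_ne_bot _)) (Or.inr (EReal.coe_ne_top _))
  have h3 : {z : A × B | (c z : EReal) ≤ f z.1 + g z.2} =
      (fun z : A × B => (f z.1 + g z.2) + ((-c z : ℝ) : EReal)) ⁻¹' Ici 0 := by
    ext z
    simp only [mem_ofPred_eq, mem_preimage, mem_Ici]
    rw [EReal.coe_neg, ← sub_eq_add_neg,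
      EReal.sub_nonneg (Or.inr (EReal.coe_ne_top _)) (Or.inr (EReal.coe_ne_bot _))]
  rw [h3]
  exact h2.isClosed_preimage 0

end Semicontinuity

/-! ### Elementary properties of the `c`-transform. -/

section Transform

variable {X Y : Type*} {c : X × Y → ℝ} {f : X → EReal}

lemma add_cTransformX_le (hf : ∀ x, f x ≠ ⊤) (x : X) (y : Y) :
    f x + cTransformX c f y ≤ c (x, y) := by
  have h : cTransformX c f y ≤ (c (x, y) : EReal) - f x := iInf_le _ x
  refine (add_le_add_right h (f x)).trans ?_
  induction hx : f x with
  | bot => simp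
  | top => exact absurd hx (hf x)
  | coe r => rw [← EReal.coe_sub, ← EReal.coe_add]; simp

lemma cTransformX_ne_top (hf : ∃ x, f x ≠ ⊥) (hf' : ∀ x, f x ≠ ⊤) (y : Y) :
    cTransformX c f y ≠ ⊤ := by
  obtain ⟨x, hx⟩ := hf
  have h : cTransformX c f y ≤ (c (x, y) : EReal) - f x := iInf_le _ x
  lift f x to ℝ using ⟨hf' x, hx⟩ with r
  exact (h.trans_lt (by rw [← EReal.coe_sub]; exact EReal.coe_lt_top _)).ne

lemma IsCConcave.upperSemicontinuous [TopologicalSpace X] [TopologicalSpace Y]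
    (hc : Continuous c) (hf : IsCConcave c f) : UpperSemicontinuous f := by
  obtain ⟨-, -, g, hg, rfl⟩ := hf
  exact upperSemicontinuous_iInf_coe_sub (k := fun x y => c (x, y))
    (fun y => hc.comp (.prodMk_left y)) hg

lemma upperSemicontinuous_cTransformX [TopologicalSpace X] [TopologicalSpace Y]
    (hc : Continuous c) (hf : ∀ x, f x ≠ ⊤) : UpperSemicontinuous (cTransformX c f) :=
  upperSemicontinuous_iInf_coe_sub (k := fun y x => c (x, y))
    (fun x => hc.comp (.prodMk_right x)) hf

end Transform

/-! ### From equality of integrals to almost sure equality. -/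

section Integral

/-- The positive part has integral `P ≤ T`, so `P - N = T` with `T` finite forces `N = 0` and `P =
T`: the negative part vanishes and the positive part equals `c`, almost everywhere. -/
lemma ae_eq_of_extIntegral_eq_lintegral {Z : Type*} [MeasurableSpace Z] {π : Measure Z}
    {h : Z → EReal} (hm : Measurable h) {c : Z → ℝ} (hc : Measurable c)
    (hc0 : ∀ z, 0 ≤ c z) (hle : ∀ z, h z ≤ c z) (hfin : ∫⁻ z, ENNReal.ofReal (c z) ∂π ≠ ⊤)
    (heq : extIntegral π h = ((∫⁻ z, ENNReal.ofReal (c z) ∂π : ℝ≥0∞) : EReal)) :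
    ∀ᵐ z ∂π, h z = c z := by
  have hmono : ∀ z, (h z).toENNReal ≤ ENNReal.ofReal (c z) := fun z =>
    (EReal.toENNReal_le_toENNReal (hle z)).trans (by simp)
  set T := ∫⁻ z, ENNReal.ofReal (c z) ∂π with hT
  set P := ∫⁻ z, (h z).toENNReal ∂π with hP
  set N := ∫⁻ z, (-h z).toENNReal ∂π with hN
  have hPT : P ≤ T := lintegral_mono hmono
  have hPfin : P ≠ ⊤ := ne_top_of_le_ne_top hfin hPT
  have heq' : (P : EReal) - (N : EReal) = (T : EReal) := heq
  have hNfin : N ≠ ⊤ := by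
    intro hN'
    rw [hN'] at heq'
    simp only [EReal.coe_ennreal_top, EReal.sub_top] at heq'
    exact EReal.coe_ennreal_ne_bot _ heq'.symm
  lift P to NNReal using hPfin with p
  lift N to NNReal using hNfin with n
  lift T to NNReal using hfin with t
  have hr : (p : ℝ) - n = t := by
    have : ((p : ℝ) : EReal) - ((n : ℝ) : EReal) = ((t : ℝ) : EReal) := heq'
    exact_mod_cast this
  have hpt : (p : ℝ) ≤ t := by exact_mod_cast hPT
  have hn0 : n = 0 := by
    have : (n : ℝ) ≤ 0 := by linarith
    exact le_antisymm (by exact_mod_cast this) (zero_le)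
  have hp : p = t := by
    subst hn0
    have : (p : ℝ) = t := by simpa using hr
    exact_mod_cast this
  have h1 : (fun z => (h z).toENNReal) =ᵐ[π] fun z => ENNReal.ofReal (c z) :=
    ae_eq_of_ae_le_of_lintegral_le (Eventually.of_forall hmono) (by rw [← hP]; simp)
      hc.ennreal_ofReal.aemeasurable (by rw [← hP, ← hT, hp])
  have h2 : ∀ᵐ z ∂π, (-h z).toENNReal = 0 := by
    rw [hn0] at hN
    exact (lintegral_eq_zero_iff (f := fun z => (-h z).toENNReal) hm.neg.ereal_toENNReal).1
      (by rw [← hN]; simp)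
  filter_upwards [h1, h2] with z hz1 hz2
  rw [EReal.toENNReal_eq_zero_iff, EReal.neg_le_zero] at hz2
  rw [← EReal.coe_toENNReal hz2, hz1, EReal.coe_ennreal_ofReal, max_eq_left (hc0 z)]

/-- Truncation of a real number to `[-n, n]`. -/
def truncation (n : ℕ) (r : ℝ) : ℝ := max (-n) (min n r)

lemma abs_truncation_le (n : ℕ) (r : ℝ) : |truncation n r| ≤ n := by
  have : (0 : ℝ) ≤ n := n.cast_nonneg
  unfold truncation
  rw [abs_le]
  exact ⟨le_max_left _ _, max_le (by linarith) (min_le_left _ _)⟩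

lemma measurable_truncation (n : ℕ) : Measurable (truncation n) := by
  unfold truncation
  fun_prop

lemma truncation_of_abs_le {n : ℕ} {r : ℝ} (h : |r| ≤ n) : truncation n r = r := by
  rw [abs_le] at h
  rw [truncation, min_eq_right h.2, max_eq_right h.1]

lemma tendsto_truncation (r : ℝ) : Tendsto (fun n : ℕ => truncation n r) atTop (𝓝 r) := by
  refine tendsto_const_nhds.congr' ?_
  filter_upwards [eventually_ge_atTop ⌈|r|⌉₊] with n hn
  exact (truncation_of_abs_le (Nat.ceil_le.1 hn)).symm

/-- If a summand is raised to `-n`, the truncated sum is at most `-n + n = 0 ≤ r`; otherwise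
truncation only lowers both. -/
lemma truncation_add_le {n : ℕ} {a b r : ℝ} (hr : 0 ≤ r) (h : a + b ≤ r) :
    truncation n a + truncation n b ≤ r := by
  have : (0 : ℝ) ≤ n := n.cast_nonneg
  unfold truncation
  grind

/-- Truncation is monotone and odd, and `-a ≤ b`. -/
lemma truncation_add_nonneg {n : ℕ} {a b : ℝ} (h : 0 ≤ a + b) :
    0 ≤ truncation n a + truncation n b := by
  have : (0 : ℝ) ≤ n := n.cast_nonneg
  unfold truncation
  grind

/-- If `u ⊕ v ≤ c` and `u ⊕ v` agrees with `c` almost surely under one coupling of finite cost,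
then it does so under every coupling whose cost is not larger. -/
lemma ae_add_eq_of_ae_add_eq {X Y : Type*} [MeasurableSpace X] [MeasurableSpace Y]
    {μ : Measure X} [IsFiniteMeasure μ] {ν : Measure Y} [IsFiniteMeasure ν]
    {π π' : Measure (X × Y)} (hπ : π ∈ couplings μ ν) (hπ' : π' ∈ couplings μ ν)
    {c : X × Y → ℝ} (hc : Measurable c) (hc0 : ∀ z, 0 ≤ c z)
    (hcost : ∫⁻ z, ENNReal.ofReal (c z) ∂π ≤ ∫⁻ z, ENNReal.ofReal (c z) ∂π')
    (hfin : ∫⁻ z, ENNReal.ofReal (c z) ∂π' ≠ ⊤)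
    {u : X → ℝ} {v : Y → ℝ} (hu : Measurable u) (hv : Measurable v)
    (hle : ∀ᵐ z ∂π, u z.1 + v z.2 ≤ c z) (heq : ∀ᵐ z ∂π', u z.1 + v z.2 = c z) :
    ∀ᵐ z ∂π, u z.1 + v z.2 = c z := by
  have hint : ∀ {ρ : Measure (X × Y)}, ∫⁻ z, ENNReal.ofReal (c z) ∂ρ ≠ ⊤ → Integrable c ρ :=
    fun h => ⟨hc.aestronglyMeasurable,
      (hasFiniteIntegral_iff_ofReal (Eventually.of_forall hc0)).2 h.lt_top⟩
  have hcπ' := hint hfin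
  have hcπ := hint (ne_top_of_le_ne_top hfin hcost)
  have hcost' : ∫ z, c z ∂π ≤ ∫ z, c z ∂π' := by
    rw [integral_eq_lintegral_of_nonneg_ae (Eventually.of_forall hc0) hc.aestronglyMeasurable,
      integral_eq_lintegral_of_nonneg_ae (Eventually.of_forall hc0) hc.aestronglyMeasurable]
    exact ENNReal.toReal_mono hfin hcost
  have htu : ∀ n, Measurable fun x => truncation n (u x) := fun n =>
    (measurable_truncation n).comp hu
  have htv : ∀ n, Measurable fun y => truncation n (v y) := fun n =>
    (measurable_truncation n).comp hv
  have hiu : ∀ n, Integrable (fun x => truncation n (u x)) μ := fun n =>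
    .of_bound (htu n).aestronglyMeasurable n (Eventually.of_forall fun x => abs_truncation_le n _)
  have hiv : ∀ n, Integrable (fun y => truncation n (v y)) ν := fun n =>
    .of_bound (htv n).aestronglyMeasurable n (Eventually.of_forall fun x => abs_truncation_le n _)
  set ξ : ℕ → X × Y → ℝ := fun n z => truncation n (u z.1) + truncation n (v z.2) with hξ
  have hξm : ∀ n, Measurable (ξ n) := fun n =>
    ((htu n).comp measurable_fst).add ((htv n).comp measurable_snd)
  -- `u` and `v` need not be integrable, but their truncations are, and the integral of `ξ n`
  -- depends on the marginals only.
  have key : ∀ {ρ : Measure (X × Y)}, ρ ∈ couplings μ ν → ∀ n, Integrable (ξ n) ρ ∧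
      ∫ z, ξ n z ∂ρ = ∫ x, truncation n (u x) ∂μ + ∫ y, truncation n (v y) ∂ν := by
    rintro ρ ⟨h1, h2⟩ n
    have i1 : Integrable (fun z : X × Y => truncation n (u z.1)) ρ := by
      have := hiu n
      rw [← h1] at this
      exact this.comp_measurable measurable_fst
    have i2 : Integrable (fun z : X × Y => truncation n (v z.2)) ρ := by
      have := hiv n
      rw [← h2] at this
      exact this.comp_measurable measurable_snd
    refine ⟨i1.add i2, ?_⟩
    rw [hξ, integral_add i1 i2, ← h1, ← h2,
      integral_map measurable_fst.aemeasurable (htu n).aestronglyMeasurable,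
      integral_map measurable_snd.aemeasurable (htv n).aestronglyMeasurable]
  have hlim : ∀ z, Tendsto (fun n => ξ n z) atTop (𝓝 (u z.1 + v z.2)) := fun z =>
    (tendsto_truncation _).add (tendsto_truncation _)
  -- Under `π'` the sum equals `c`, so `0 ≤ ξ n ≤ c` and `c` dominates.
  have hlim' : Tendsto (fun n => ∫ z, ξ n z ∂π') atTop (𝓝 (∫ z, c z ∂π')) := by
    refine tendsto_integral_of_dominated_convergence c (fun n => (hξm n).aestronglyMeasurable)
      hcπ' (fun n => ?_) ?_
    · filter_upwards [heq] with z hz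
      rw [Real.norm_of_nonneg (truncation_add_nonneg (hz ▸ hc0 z))]
      exact truncation_add_le (hc0 z) hz.le
    · filter_upwards [heq] with z hz
      exact hz ▸ hlim z
  have hlimπ : Tendsto (fun n => ∫⁻ z, ENNReal.ofReal (c z - ξ n z) ∂π) atTop (𝓝 0) := by
    have h1 : ∀ n, ∫⁻ z, ENNReal.ofReal (c z - ξ n z) ∂π =
        ENNReal.ofReal (∫ z, c z ∂π - ∫ z, ξ n z ∂π') := by
      intro n
      rw [(key hπ' n).2, ← (key hπ n).2, ← integral_sub hcπ (key hπ n).1,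
        ofReal_integral_eq_lintegral_ofReal (f := fun z => c z - ξ n z) (hcπ.sub (key hπ n).1)]
      filter_upwards [hle] with z hz
      exact sub_nonneg.2 (truncation_add_le (hc0 z) hz)
    simp_rw [h1]
    have h2 : Tendsto (fun n => ENNReal.ofReal (∫ z, c z ∂π - ∫ z, ξ n z ∂π')) atTop
        (𝓝 (ENNReal.ofReal (∫ z, c z ∂π - ∫ z, c z ∂π'))) :=
      (ENNReal.continuous_ofReal.tendsto _).comp (tendsto_const_nhds.sub hlim')
    rwa [ENNReal.ofReal_of_nonpos (sub_nonpos.2 hcost')] at h2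
  -- Fatou: the gaps `c - ξ n` converge pointwise to `c - (u ⊕ v)`, and their integrals under `π`
  -- tend to zero.
  have hzero : ∫⁻ z, ENNReal.ofReal (c z - (u z.1 + v z.2)) ∂π = 0 := by
    refine le_antisymm ?_ zero_le
    calc ∫⁻ z, ENNReal.ofReal (c z - (u z.1 + v z.2)) ∂π
        = ∫⁻ z, liminf (fun n => ENNReal.ofReal (c z - ξ n z)) atTop ∂π := by
          refine lintegral_congr fun z => (Tendsto.liminf_eq ?_).symm
          exact (ENNReal.continuous_ofReal.tendsto _).comp (tendsto_const_nhds.sub (hlim z))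
      _ ≤ liminf (fun n => ∫⁻ z, ENNReal.ofReal (c z - ξ n z) ∂π) atTop :=
          lintegral_liminf_le fun n => (hc.sub (hξm n)).ennreal_ofReal
      _ = 0 := hlimπ.liminf_eq
  rw [lintegral_eq_zero_iff (by fun_prop)] at hzero
  filter_upwards [hle, hzero] with z hz1 hz2
  have : c z - (u z.1 + v z.2) ≤ 0 := ENNReal.ofReal_eq_zero.1 hz2
  linarith

end Integral

end KantorovichPotentials

namespace KantorovichPotentials

open Filter

/-! ### Lipschitz functions and touching functions on Euclidean space. -/

section Euclidean

variable {E : Type*} [NormedAddCommGroup E] [NormedSpace ℝ E]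

/-- A Lipschitz function on an open convex set whose derivative vanishes almost everywhere is
constant. -/
lemma eq_of_lipschitzOnWith_of_ae_hasFDerivAt_zero [FiniteDimensional ℝ E] [MeasurableSpace E]
    [BorelSpace E] (μ : Measure E) [μ.IsAddHaarMeasure] {f : E → ℝ} {C : NNReal} {U : Set E}
    (hU : IsOpen U) (hconv : Convex ℝ U) (hf : LipschitzOnWith C f U)
    (h : ∀ᵐ x ∂μ, x ∈ U → HasFDerivAt f (0 : E →L[ℝ] ℝ) x) {p q : E} (hp : p ∈ U) (hq : q ∈ U) :
    f q = f p := by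
  obtain ⟨w, rfl⟩ : ∃ w, q = p + w := ⟨q - p, by simp⟩
  -- A measurable set of full measure inside the good set, as Fubini requires.
  set S := (toMeasurable μ {x | ¬ (x ∈ U → HasFDerivAt f (0 : E →L[ℝ] ℝ) x)})ᶜ with hS
  have hSm : MeasurableSet S := (measurableSet_toMeasurable _ _).compl
  have hSae : ∀ᵐ x ∂μ, x ∈ S := by
    rw [ae_iff] at h ⊢
    simpa [hS, measure_toMeasurable] using h
  have hSsub : ∀ x ∈ S, x ∈ U → HasFDerivAt f (0 : E →L[ℝ] ℝ) x := fun x hx => by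
    by_contra hcon
    exact hx (subset_toMeasurable _ _ hcon)
  -- For almost every `x`, almost every point of the line `x + t • w` is good.
  have hline := (ae_ae_add_linearMap_mem_iff (LinearMap.toSpanSingleton ℝ E w) volume μ hSm).2 hSae
  have hstep : ∀ᵐ x ∂μ, x ∈ U → x + w ∈ U → f (x + w) = f x := by
    filter_upwards [hline] with x hx hxU hxwU
    have hmem : ∀ t ∈ Icc (0 : ℝ) 1, x + t • w ∈ U := fun t ht =>
      hconv.add_smul_mem hxU hxwU ht
    have hlip : LipschitzOnWith (C * ‖w‖₊) (fun t : ℝ => f (x + t • w)) (uIcc 0 1) := by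
      rw [uIcc_of_le zero_le_one]
      refine LipschitzOnWith.of_dist_le_mul fun s hs t ht => ?_
      refine (hf.dist_le_mul _ (hmem s hs) _ (hmem t ht)).trans_eq ?_
      rw [dist_add_left, dist_eq_norm, ← sub_smul, norm_smul, NNReal.coe_mul, coe_nnnorm,
        dist_eq_norm]
      ring
    have hftc := hlip.absolutelyContinuousOnInterval.integral_deriv_eq_sub
    rw [intervalIntegral.integral_congr_ae (g := fun _ => (0 : ℝ))] at hftc
    · simp only [intervalIntegral.integral_zero, one_smul, zero_smul, add_zero] at hftc
      linarith
    · filter_upwards [hx] with t ht htI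
      rw [uIoc_of_le zero_le_one] at htI
      have hd : HasFDerivAt f (0 : E →L[ℝ] ℝ) (x + t • w) :=
        hSsub _ ht (hmem t ⟨htI.1.le, htI.2⟩)
      have hl : HasDerivAt (fun t : ℝ => x + t • w) w t := by
        simpa using ((hasDerivAt_id t).smul_const w).const_add x
      have hcomp : HasDerivAt (fun t : ℝ => f (x + t • w)) 0 t := by
        simpa using! hd.comp_hasDerivAt t hl
      exact hcomp.deriv
  -- The segment from `p` itself may be bad; good starting points are dense, and continuity
  -- transfers the equality to `p`.
  have hcont : ContinuousAt (fun x => f (x + w) - f x) p :=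
    ((hf.continuousOn.continuousAt (hU.mem_nhds hq)).comp (f := fun x => x + w)
      (by fun_prop)).sub (hf.continuousOn.continuousAt (hU.mem_nhds hp))
  have hfreq : ∃ᶠ x in 𝓝 p, x ∈ U → x + w ∈ U → f (x + w) = f x :=
    mem_closure_iff_frequently.1 (Measure.dense_of_ae hstep p)
  have hev : ∀ᶠ x in 𝓝 p, x ∈ U ∧ x + w ∈ U :=
    (hU.eventually_mem hp).and
      ((continuous_add_const w).continuousAt.eventually (hU.eventually_mem hq))
  by_contra hne
  have hev' : ∀ᶠ x in 𝓝 p, f (x + w) - f x ≠ 0 := hcont.eventually_ne (sub_ne_zero.2 hne)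
  obtain ⟨x, hx, ⟨h1, h2⟩, h3⟩ := (hfreq.and_eventually (hev.and hev')).exists
  exact h3 (sub_eq_zero.2 (hx h1 h2))

/-- `k - u` has a local minimum at `w`. The resulting derivative `k'` does not depend on `u`, which
is what makes two potentials comparable. -/
lemma hasFDerivAt_of_eventually_le_sub_const {u k : E → ℝ} {k' : E →L[ℝ] ℝ} {w : E} {b : ℝ}
    (hu : DifferentiableAt ℝ u w) (hk : HasFDerivAt k k' w) (hle : ∀ᶠ x in 𝓝 w, u x + b ≤ k x)
    (heq : u w + b = k w) : HasFDerivAt u k' w := by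
  have hmin : IsLocalMin (fun x => k x - u x) w := by
    filter_upwards [hle] with x hx
    linarith
  have h0 := hmin.hasFDerivAt_eq_zero (hk.sub hu.hasFDerivAt)
  rw [sub_eq_zero.1 h0]
  exact hu.hasFDerivAt

end Euclidean

end KantorovichPotentials

namespace KantorovichPotentials

open Filter

/-! ### Supports of plans and induced regularity. -/

section Support

variable {X Y : Type*} [TopologicalSpace X] [TopologicalSpace Y]

lemma fst_mem_support_of_mem_support [MeasurableSpace X] [BorelSpace X] [MeasurableSpace Y]
    {μ : Measure X} {π : Measure (X × Y)} (hπ : π.map Prod.fst = μ) {z : X × Y}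
    (hz : z ∈ π.support) : z.1 ∈ μ.support := by
  rw [Measure.support_eq_forall_isOpen] at hz ⊢
  intro u hu huo
  rw [← hπ, Measure.map_apply measurable_fst huo.measurableSet]
  exact hz _ hu (huo.preimage continuous_fst)

/-- The projection of `supp π` need not be closed, but it is dense in `supp μ`: the strip over `u`
has positive mass and so meets the support. -/
lemma exists_mem_support_of_isOpen [MeasurableSpace X] [BorelSpace X] [MeasurableSpace Y]
    [SecondCountableTopology X] [SecondCountableTopology Y]
    {μ : Measure X} {π : Measure (X × Y)} (hπ : π.map Prod.fst = μ) {x : X} (hx : x ∈ μ.support)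
    {u : Set X} (hu : IsOpen u) (hxu : x ∈ u) : ∃ z ∈ π.support, z.1 ∈ u := by
  have h0 : 0 < π (Prod.fst ⁻¹' u) := by
    rw [← Measure.map_apply measurable_fst hu.measurableSet, hπ]
    rw [Measure.support_eq_forall_isOpen] at hx
    exact hx u hxu hu
  obtain ⟨z, hz1, hz2⟩ := Measure.nonempty_inter_support_of_pos h0
  exact ⟨z, hz2, hz1⟩

/-- If `π` induces regularity on a relatively open subset of `supp μ`, through the compact set `K`,
then each point of that subset is coupled with a point of `K`. -/
lemma exists_mem_support_of_inducesRegularityOn [MeasurableSpace X] [BorelSpace X]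
    [MeasurableSpace Y] [SecondCountableTopology X] [SecondCountableTopology Y]
    {μ : Measure X} {π : Measure (X × Y)} (hπ : π.map Prod.fst = μ) {O : Set X} (hO : IsOpen O)
    {K : Set Y} (hK : IsCompact K)
    (h : Prod.fst '' π.support ∩ (O ∩ μ.support) =
      Prod.fst '' (π.support ∩ (O ∩ μ.support) ×ˢ K)) {x : X} (hx : x ∈ O ∩ μ.support) :
    ∃ y ∈ K, (x, y) ∈ π.support := by
  by_contra! hcon
  have hgen : ∀ y ∈ K, ∀ᶠ p : X × Y in 𝓝 x ×ˢ 𝓝 y, p ∉ π.support := fun y hy => by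
    rw [← nhds_prod_eq]
    exact Measure.isOpen_compl_support.mem_nhds (hcon y hy)
  -- Tube lemma: a whole neighbourhood of `x` would have no partner in `K`, although it contains
  -- projected support points, which regularity couples with `K`.
  have hev : ∀ᶠ x' in 𝓝 x, ∀ y ∈ K, (x', y) ∉ π.support :=
    hK.eventually_forall_of_forall_eventually fun y hy => by
      rw [nhds_prod_eq]
      exact hgen y hy
  obtain ⟨u, hu, huo, hxu⟩ := eventually_nhds_iff.1 hev
  obtain ⟨z, hz, hzu⟩ := exists_mem_support_of_isOpen hπ hx.2 (huo.inter hO) ⟨hxu, hx.1⟩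
  have hmem : z.1 ∈ Prod.fst '' π.support ∩ (O ∩ μ.support) :=
    ⟨mem_image_of_mem _ hz, hzu.2, fst_mem_support_of_mem_support hπ hz⟩
  rw [h] at hmem
  obtain ⟨⟨x', y⟩, ⟨hz', -, hy⟩, hzx⟩ := hmem
  simp only at hzx hy
  subst hzx
  exact hu _ hzu.1 y hy hz'

lemma inducesRegularityAt_of_mem_diff [MeasurableSpace X] [MeasurableSpace Y] {μ : Measure X}
    {π : Measure (X × Y)} {x : X} (hx : x ∈ μ.support \ irregularSet μ π) :
    InducesRegularityAt μ π x := by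
  by_contra h
  exact hx.2 ⟨hx.1, h⟩

/-- A neighbourhood witnessing regularity at one point serves all its points in `supp μ`, so the
regular set is relatively open there. -/
lemma measurableSet_support_diff_irregularSet [MeasurableSpace X] [BorelSpace X]
    [MeasurableSpace Y] (μ : Measure X) (π : Measure (X × Y)) :
    MeasurableSet (μ.support \ irregularSet μ π) := by
  have : μ.support \ irregularSet μ π =
      μ.support ∩ ⋃₀ {O | IsOpen O ∧ InducesRegularityOn π (O ∩ μ.support)} := by
    ext x
    simp only [irregularSet, InducesRegularityAt, Set.mem_sdiff, mem_inter_iff, mem_sUnion,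
      mem_ofPred_eq, not_and, not_not]
    constructor
    · rintro ⟨hx, h⟩
      obtain ⟨O, hO, hxO, h⟩ := h hx
      exact ⟨hx, O, ⟨hO, h⟩, hxO.1⟩
    · rintro ⟨hx, O, ⟨hO, h⟩, hxO⟩
      exact ⟨hx, fun _ => ⟨O, hO, ⟨hxO, hx⟩, h⟩⟩
  rw [this]
  exact Measure.isClosed_support.measurableSet.inter
    (isOpen_sUnion fun O hO => hO.1).measurableSet

end Support

/-! ### Duality on the support of an arbitrary optimal plan. -/

section Potential

variable {X Y : Type*} [TopologicalSpace X] [TopologicalSpace Y]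
  [SecondCountableTopology Y] [MeasurableSpace X] [BorelSpace X] [MeasurableSpace Y] [BorelSpace Y]
  {μ : Measure X} [IsFiniteMeasure μ] {ν : Measure Y} [IsFiniteMeasure ν]
  {c : X × Y → ℝ} {π : Measure (X × Y)} {f : X → EReal}

/-- A Kantorovich potential and its transform add up to the cost on the support of every optimal
transport plan. -/
lemma IsKantorovichPotential.add_eq_of_mem_support (hf : IsKantorovichPotential c μ ν f)
    (hc0 : ∀ z, 0 ≤ c z) (hc : Continuous c) (hfin : transportCost c μ ν < ⊤)
    (hπ : IsOptimalPlan c μ ν π) {z : X × Y} (hz : z ∈ π.support) :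
    f z.1 + cTransformX c f z.2 = c z := by
  obtain ⟨hcc, π', hπ', hint⟩ := hf
  have hft := hcc.1
  have hgt := cTransformX_ne_top (c := c) hcc.2.1 hft
  have hle : ∀ z : X × Y, f z.1 + cTransformX c f z.2 ≤ c z := fun z =>
    add_cTransformX_le hft z.1 z.2
  have hfusc := hcc.upperSemicontinuous hc
  have hgusc := upperSemicontinuous_cTransformX hc hft
  have hfm : Measurable f := hfusc.measurable
  have hgm : Measurable (cTransformX c f) := hgusc.measurable
  have hae' : ∀ᵐ z ∂π', f z.1 + cTransformX c f z.2 = c z := by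
    refine ae_eq_of_extIntegral_eq_lintegral
      ((hfm.comp measurable_fst).add (hgm.comp measurable_snd)) hc.measurable hc0 hle ?_ ?_
    · rw [hπ'.2]; exact hfin.ne
    · rw [hπ'.2]; exact hint
  -- Finiteness of `f` concerns the first marginal alone, which `π` and `π'` share.
  have hfb : ∀ᵐ z ∂π, f z.1 ≠ ⊥ := by
    have h1 : ∀ᵐ x ∂π'.map Prod.fst, f x ≠ ⊥ := by
      rw [ae_map_iff measurable_fst.aemeasurable
        (p := fun x => f x ≠ ⊥) (hfm (measurableSet_singleton ⊥)).compl]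
      filter_upwards [hae'] with z hz h
      rw [h, EReal.bot_add] at hz
      exact EReal.bot_ne_coe _ hz
    rw [hπ'.1.1, ← hπ.1.1] at h1
    exact ae_of_ae_map measurable_fst.aemeasurable h1
  have hgb : ∀ᵐ z ∂π, cTransformX c f z.2 ≠ ⊥ := by
    have h1 : ∀ᵐ y ∂π'.map Prod.snd, cTransformX c f y ≠ ⊥ := by
      rw [ae_map_iff measurable_snd.aemeasurable
        (p := fun y => cTransformX c f y ≠ ⊥) (hgm (measurableSet_singleton ⊥)).compl]
      filter_upwards [hae'] with z hz h
      rw [h, EReal.add_bot] at hz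
      exact EReal.bot_ne_coe _ hz
    rw [hπ'.1.2, ← hπ.1.2] at h1
    exact ae_of_ae_map measurable_snd.aemeasurable h1
  have hreal : ∀ᵐ z ∂π, (f z.1).toReal + (cTransformX c f z.2).toReal = c z := by
    refine ae_add_eq_of_ae_add_eq hπ.1 hπ'.1 hc.measurable hc0 (hπ.2.trans hπ'.2.symm).le
      (hπ'.2 ▸ hfin.ne) hfm.ereal_toReal hgm.ereal_toReal ?_ ?_
    · filter_upwards [hfb, hgb] with z h1 h2
      rw [← EReal.coe_le_coe_iff, EReal.coe_add, EReal.coe_toReal (hft _) h1,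
        EReal.coe_toReal (hgt _) h2]
      exact hle z
    · filter_upwards [hae'] with z h
      have h1 : f z.1 ≠ ⊥ := fun h1 => by
        rw [h1, EReal.bot_add] at h
        exact EReal.bot_ne_coe _ h
      have h2 : cTransformX c f z.2 ≠ ⊥ := fun h2 => by
        rw [h2, EReal.add_bot] at h
        exact EReal.bot_ne_coe _ h
      rw [← EReal.toReal_add (hft _) h1 (hgt _) h2, h, EReal.toReal_coe]
  have hae : ∀ᵐ z ∂π, (c z : EReal) ≤ f z.1 + cTransformX c f z.2 := by
    filter_upwards [hreal, hfb, hgb] with z h h1 h2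
    rw [← h, EReal.coe_add, EReal.coe_toReal (hft _) h1, EReal.coe_toReal (hgt _) h2]
  exact (hle z).antisymm (Measure.support_subset_of_isClosed
    (isClosed_le_add hfusc hgusc hft hgt hc) hae hz)

/-- The real-valued form of the duality relations between a Kantorovich potential and its
transform. -/
lemma IsKantorovichPotential.exists_real (hf : IsKantorovichPotential c μ ν f)
    (hc0 : ∀ z, 0 ≤ c z) (hc : Continuous c) (hfin : transportCost c μ ν < ⊤)
    (hπ : IsOptimalPlan c μ ν π) :
    ∃ (F : X → ℝ) (G : Y → ℝ), (∀ x ∈ Prod.fst '' π.support, f x = F x) ∧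
      (∀ z ∈ π.support, F z.1 + G z.2 = c z) ∧
      ∀ x ∈ Prod.fst '' π.support, ∀ y ∈ Prod.snd '' π.support, F x + G y ≤ c (x, y) := by
  have hft := hf.1.1
  have hgt := cTransformX_ne_top (c := c) hf.1.2.1 hft
  have hsum : ∀ z ∈ π.support, f z.1 + cTransformX c f z.2 = c z := fun z hz =>
    hf.add_eq_of_mem_support hc0 hc hfin hπ hz
  have hF : ∀ x ∈ Prod.fst '' π.support, f x = (f x).toReal := by
    rintro _ ⟨z, hz, rfl⟩
    refine (EReal.coe_toReal (hft _) fun h => ?_).symm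
    have := hsum z hz
    rw [h, EReal.bot_add] at this
    exact EReal.bot_ne_coe _ this
  have hG : ∀ y ∈ Prod.snd '' π.support, cTransformX c f y = (cTransformX c f y).toReal := by
    rintro _ ⟨z, hz, rfl⟩
    refine (EReal.coe_toReal (hgt _) fun h => ?_).symm
    have := hsum z hz
    rw [h, EReal.add_bot] at this
    exact EReal.bot_ne_coe _ this
  -- `toReal` sends infinite values to `0`, hence the restriction of the relations to the
  -- projections of the support.
  refine ⟨fun x => (f x).toReal, fun y => (cTransformX c f y).toReal, hF, fun z hz => ?_,
    fun x hx y hy => ?_⟩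
  · have := hsum z hz
    rw [hF _ (mem_image_of_mem _ hz), hG _ (mem_image_of_mem _ hz)] at this
    exact_mod_cast this
  · have := add_cTransformX_le (c := c) hft x y
    rw [hF x hx, hG y hy] at this
    exact_mod_cast this

end Potential

/-! ### Derivatives of potentials in charts. -/

section Gradient

variable {d : ℕ} {X Y : Type*} [TopologicalSpace X]
  [ChartedSpace (EuclideanSpace ℝ (Fin d)) X] [MeasurableSpace X]
  [TopologicalSpace Y] [MeasurableSpace Y] {π : Measure (X × Y)} {c : X × Y → ℝ}

/-- If two potentials are differentiable in a chart, at a point coupled with some `y` such that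
`c(·, y)` is differentiable there, then their derivatives agree. -/
lemma hasFDerivAt_chart_sub_zero [IsManifold (𝓡 d) 1 X] {F₁ F₂ : X → ℝ} {G₁ G₂ : Y → ℝ}
    (heq₁ : ∀ z ∈ π.support, F₁ z.1 + G₁ z.2 = c z)
    (hle₁ : ∀ x ∈ Prod.fst '' π.support, ∀ y ∈ Prod.snd '' π.support, F₁ x + G₁ y ≤ c (x, y))
    (heq₂ : ∀ z ∈ π.support, F₂ z.1 + G₂ z.2 = c z)
    (hle₂ : ∀ x ∈ Prod.fst '' π.support, ∀ y ∈ Prod.snd '' π.support, F₂ x + G₂ y ≤ c (x, y))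
    {φ : OpenPartialHomeomorph X (EuclideanSpace ℝ (Fin d))}
    (hφ : φ ∈ atlas (EuclideanSpace ℝ (Fin d)) X) {w : EuclideanSpace ℝ (Fin d)}
    (hw : w ∈ φ.target) (hsupp : ∀ᶠ v in 𝓝 w, φ.symm v ∈ Prod.fst '' π.support)
    (hgrad : φ.symm w ∈ Prod.fst '' gradientSet d c π)
    (hd₁ : DifferentiableAt ℝ (F₁ ∘ φ.symm) w) (hd₂ : DifferentiableAt ℝ (F₂ ∘ φ.symm) w) :
    HasFDerivAt (fun v => F₁ (φ.symm v) - F₂ (φ.symm v))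
      (0 : EuclideanSpace ℝ (Fin d) →L[ℝ] ℝ) w := by
  obtain ⟨⟨x, y⟩, ⟨hz, hdiff⟩, hx⟩ := hgrad
  simp only at hx hdiff
  subst hx
  have hk : DifferentiableAt ℝ (fun v => c (φ.symm v, y)) w :=
    (MDifferentiableAt.comp w hdiff (mdifferentiableAt_atlas_symm hφ hw)).differentiableAt
  have h : ∀ {F : X → ℝ} {G : Y → ℝ}, (∀ z ∈ π.support, F z.1 + G z.2 = c z) →
      (∀ x ∈ Prod.fst '' π.support, ∀ y ∈ Prod.snd '' π.support, F x + G y ≤ c (x, y)) →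
      DifferentiableAt ℝ (F ∘ φ.symm) w →
      HasFDerivAt (F ∘ φ.symm) (fderiv ℝ (fun v => c (φ.symm v, y)) w) w :=
    fun {F G} heq hle hd => hasFDerivAt_of_eventually_le_sub_const (b := G y) hd hk.hasFDerivAt
      (hsupp.mono fun v hv => hle _ hv _ ⟨_, hz, rfl⟩) (heq _ hz)
  simpa using! (h heq₁ hle₁ hd₁).sub (h heq₂ hle₂ hd₂)

end Gradient

/-! ### Regularity of potentials and constancy of their difference. -/

section Uniqueness

variable {d : ℕ} {X Y : Type*} [TopologicalSpace X] [SecondCountableTopology X]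
  [ChartedSpace (EuclideanSpace ℝ (Fin d)) X] [MeasurableSpace X] [BorelSpace X]
  [TopologicalSpace Y] [SecondCountableTopology Y] [MeasurableSpace Y]
  {μ : Measure X} {π : Measure (X × Y)} {c : X × Y → ℝ}

local notation "chart" => chartAt (EuclideanSpace ℝ (Fin d))

lemma mem_fst_image_support_of_mem_diff_irregularSet (hπ : π.map Prod.fst = μ) {x : X}
    (hx : x ∈ μ.support \ irregularSet μ π) : x ∈ Prod.fst '' π.support := by
  obtain ⟨O, hO, hxO, K, hK, hOK⟩ := inducesRegularityAt_of_mem_diff hx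
  obtain ⟨y, -, hy⟩ := exists_mem_support_of_inducesRegularityOn hπ hO hK hOK hxO
  exact ⟨(x, y), hy, rfl⟩

/-- In a chart at a point at which `π` induces regularity, a potential is Lipschitz on the support
of `μ`. -/
lemma exists_lipschitzOnWith_chart (hπ : π.map Prod.fst = μ)
    (hc : LocallyLipschitzLocallyUniformly d c) {F : X → ℝ} {G : Y → ℝ}
    (heq : ∀ z ∈ π.support, F z.1 + G z.2 = c z)
    (hle : ∀ x ∈ Prod.fst '' π.support, ∀ y ∈ Prod.snd '' π.support, F x + G y ≤ c (x, y))
    {x : X} (hx : x ∈ μ.support \ irregularSet μ π) :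
    ∃ L : NNReal, ∃ V ∈ 𝓝 (chart x x), V ⊆ (chart x).target ∧
      LipschitzOnWith L (F ∘ (chart x).symm) (V ∩ (chart x).symm ⁻¹' μ.support) := by
  obtain ⟨O, hO, hxO, K, hK, hOK⟩ := inducesRegularityAt_of_mem_diff hx
  obtain ⟨L, V, hV, hVt, hLip⟩ := hc K hK (chart x) (chart_mem_atlas _ x) (chart x x)
    (mem_chart_target _ x)
  have hpre : (chart x).symm ⁻¹' O ∈ 𝓝 (chart x x) := by
    refine ((chart x).continuousAt_symm (mem_chart_target _ x)).preimage_mem_nhds ?_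
    rw [(chart x).left_inv (mem_chart_source _ x)]
    exact hO.mem_nhds hxO.1
  refine ⟨L, V ∩ (chart x).symm ⁻¹' O, inter_mem hV hpre, inter_subset_left.trans hVt, ?_⟩
  refine LipschitzOnWith.of_le_add_mul L ?_
  rintro v ⟨⟨hvV, hvO⟩, hvμ⟩ w ⟨⟨hwV, hwO⟩, hwμ⟩
  -- The partner `y ∈ K` of `w` gives `F v - F w ≤ c(v, y) - c(w, y)`; `y'` only shows that `v` lies
  -- over the support.
  obtain ⟨y, hyK, hy⟩ := exists_mem_support_of_inducesRegularityOn hπ hO hK hOK ⟨hwO, hwμ⟩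
  obtain ⟨y', -, hy'⟩ := exists_mem_support_of_inducesRegularityOn hπ hO hK hOK ⟨hvO, hvμ⟩
  have h1 := heq _ hy
  have h2 := hle _ ⟨_, hy', rfl⟩ _ ⟨_, hy, rfl⟩
  have h3 := (hLip y hyK).le_add_mul hvV hwV
  simp only [Function.comp_apply] at *
  linarith

/-- Continuity holds also at regular points outside the interior, since the chart estimate is
relative to `supp μ`. This carries the constant from `M` to its closure. -/
lemma continuousOn_of_potential (hπ : π.map Prod.fst = μ)
    (hc : LocallyLipschitzLocallyUniformly d c) {F : X → ℝ} {G : Y → ℝ}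
    (heq : ∀ z ∈ π.support, F z.1 + G z.2 = c z)
    (hle : ∀ x ∈ Prod.fst '' π.support, ∀ y ∈ Prod.snd '' π.support, F x + G y ≤ c (x, y)) :
    ContinuousOn F (μ.support \ irregularSet μ π) := by
  intro x hx
  obtain ⟨L, V, hV, -, hLip⟩ := exists_lipschitzOnWith_chart hπ hc heq hle hx
  have h1 : ContinuousWithinAt (F ∘ (chart x).symm) (V ∩ (chart x).symm ⁻¹' μ.support)
      (chart x x) :=
    hLip.continuousOn _ ⟨mem_of_mem_nhds hV, by
      rw [mem_preimage, (chart x).left_inv (mem_chart_source _ x)]; exact hx.1⟩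
  have h2 : (chart x) ⁻¹' V ∩ (chart x).source ∈ 𝓝 x :=
    inter_mem ((mem_chart_source _ x |> (chart x).continuousAt).preimage_mem_nhds hV)
      ((chart x).open_source.mem_nhds (mem_chart_source _ x))
  rw [← continuousWithinAt_inter h2]
  refine (h1.comp (f := chart x) ((chart x).continuousAt (mem_chart_source _ x)).continuousWithinAt
    ?_).congr ?_ ?_
  · rintro x' ⟨hx', hxV, hxs⟩
    refine ⟨hxV, ?_⟩
    rw [mem_preimage, (chart x).left_inv hxs]
    exact hx'.1
  · rintro x' ⟨-, -, hxs⟩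
    simp [(chart x).left_inv hxs]
  · simp [(chart x).left_inv (mem_chart_source _ x)]

lemma eventually_sub_eq_of_mem_interior [IsManifold (𝓡 d) 1 X] (hπ : π.map Prod.fst = μ)
    (hc : LocallyLipschitzLocallyUniformly d c) {F₁ F₂ : X → ℝ} {G₁ G₂ : Y → ℝ}
    (heq₁ : ∀ z ∈ π.support, F₁ z.1 + G₁ z.2 = c z)
    (hle₁ : ∀ x ∈ Prod.fst '' π.support, ∀ y ∈ Prod.snd '' π.support, F₁ x + G₁ y ≤ c (x, y))
    (heq₂ : ∀ z ∈ π.support, F₂ z.1 + G₂ z.2 = c z)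
    (hle₂ : ∀ x ∈ Prod.fst '' π.support, ∀ y ∈ Prod.snd '' π.support, F₂ x + G₂ y ≤ c (x, y))
    (hgrad : HasFullLebesgueMeasureInCharts d (interior (μ.support \ irregularSet μ π))
      (Prod.fst '' gradientSet d c π)) {x : X}
    (hx : x ∈ interior (μ.support \ irregularSet μ π)) :
    ∀ᶠ x' in 𝓝 x, F₁ x' - F₂ x' = F₁ x - F₂ x := by
  have hxS := interior_subset hx
  obtain ⟨L₁, V₁, hV₁, -, hLip₁⟩ := exists_lipschitzOnWith_chart hπ hc heq₁ hle₁ hxS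
  obtain ⟨L₂, V₂, hV₂, -, hLip₂⟩ := exists_lipschitzOnWith_chart hπ hc heq₂ hle₂ hxS
  set φ := chart x with hφ
  set M := interior (μ.support \ irregularSet μ π) with hM
  have hxs : x ∈ φ.source := mem_chart_source _ x
  have hφx : φ x ∈ φ.target := mem_chart_target _ x
  have hpre : φ.symm ⁻¹' M ∈ 𝓝 (φ x) := by
    refine (φ.continuousAt_symm hφx).preimage_mem_nhds ?_
    rw [φ.left_inv hxs]
    exact isOpen_interior.mem_nhds hx
  obtain ⟨r, hr, hball⟩ := Metric.mem_nhds_iff.1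
    (inter_mem (inter_mem hV₁ hV₂) (inter_mem hpre (φ.open_target.mem_nhds hφx)))
  set B := Metric.ball (φ x) r with hB
  have hBM : ∀ v ∈ B, φ.symm v ∈ M := fun v hv => (hball hv).2.1
  have hBt : ∀ v ∈ B, v ∈ φ.target := fun v hv => (hball hv).2.2
  have hBμ : ∀ v ∈ B, φ.symm v ∈ μ.support := fun v hv => (interior_subset (hBM v hv)).1
  replace hLip₁ := hLip₁.mono (s := B) fun v hv => ⟨(hball hv).1.1, hBμ v hv⟩
  replace hLip₂ := hLip₂.mono (s := B) fun v hv => ⟨(hball hv).1.2, hBμ v hv⟩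
  have hae : ∀ᵐ v, v ∈ B → HasFDerivAt (fun v => F₁ (φ.symm v) - F₂ (φ.symm v))
      (0 : EuclideanSpace ℝ (Fin d) →L[ℝ] ℝ) v := by
    -- Almost every `v` in the ball avoids the exceptional set of the gradient hypothesis and is a
    -- Rademacher point of both potentials.
    have hnull := measure_eq_zero_iff_ae_notMem.1 (hgrad φ (chart_mem_atlas _ x))
    filter_upwards [hnull, hLip₁.ae_differentiableWithinAt_of_mem (μ := volume),
      hLip₂.ae_differentiableWithinAt_of_mem (μ := volume)] with v hv hd₁ hd₂ hvB
    have hBv : B ∈ 𝓝 v := Metric.isOpen_ball.mem_nhds hvB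
    refine hasFDerivAt_chart_sub_zero heq₁ hle₁ heq₂ hle₂ (chart_mem_atlas _ x) (hBt v hvB) ?_ ?_
      ((hd₁ hvB).differentiableAt hBv) ((hd₂ hvB).differentiableAt hBv)
    · filter_upwards [hBv] with u hu
      exact mem_fst_image_support_of_mem_diff_irregularSet hπ (interior_subset (hBM u hu))
    · by_contra hcon
      refine hv ⟨⟨φ.symm v, ⟨φ.map_target (hBt v hvB), hBM v hvB⟩, φ.right_inv (hBt v hvB)⟩, ?_⟩
      rintro ⟨x', ⟨hx', hxs', -⟩, rfl⟩
      rw [φ.left_inv hxs'] at hcon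
      exact hcon hx'
  have hxB : B ∈ 𝓝 (φ x) := Metric.ball_mem_nhds _ hr
  filter_upwards [(φ.continuousAt hxs).preimage_mem_nhds hxB, φ.open_source.mem_nhds hxs]
    with x' hx' hxs'
  have := eq_of_lipschitzOnWith_of_ae_hasFDerivAt_zero volume Metric.isOpen_ball
    (convex_ball _ _) (hLip₁.sub hLip₂) hae (mem_of_mem_nhds hxB) hx'
  simpa only [Function.comp_apply, φ.left_inv hxs, φ.left_inv hxs'] using this

/-- Two potentials differ by a constant on the set of points at which `π` induces regularity. -/
lemma exists_sub_eq_const [IsManifold (𝓡 d) 1 X] (hπ : π.map Prod.fst = μ)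
    (hc : LocallyLipschitzLocallyUniformly d c) {F₁ F₂ : X → ℝ} {G₁ G₂ : Y → ℝ}
    (heq₁ : ∀ z ∈ π.support, F₁ z.1 + G₁ z.2 = c z)
    (hle₁ : ∀ x ∈ Prod.fst '' π.support, ∀ y ∈ Prod.snd '' π.support, F₁ x + G₁ y ≤ c (x, y))
    (heq₂ : ∀ z ∈ π.support, F₂ z.1 + G₂ z.2 = c z)
    (hle₂ : ∀ x ∈ Prod.fst '' π.support, ∀ y ∈ Prod.snd '' π.support, F₂ x + G₂ y ≤ c (x, y))
    (h_conn : IsConnected (interior (μ.support \ irregularSet μ π)))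
    (h_closure : closure (interior (μ.support \ irregularSet μ π)) = μ.support)
    (hgrad : HasFullLebesgueMeasureInCharts d (interior (μ.support \ irregularSet μ π))
      (Prod.fst '' gradientSet d c π)) :
    ∃ a : ℝ, ∀ x ∈ μ.support \ irregularSet μ π, F₁ x - F₂ x = a := by
  obtain ⟨x₀, hx₀⟩ := h_conn.nonempty
  refine ⟨F₁ x₀ - F₂ x₀, ?_⟩
  have hloc : IsLocallyConstant fun x : interior (μ.support \ irregularSet μ π) =>
      F₁ x - F₂ x := by
    refine (IsLocallyConstant.iff_eventually_eq _).2 fun x => ?_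
    exact continuous_subtype_val.continuousAt.eventually
      (eventually_sub_eq_of_mem_interior hπ hc heq₁ hle₁ heq₂ hle₂ hgrad x.2)
  have : PreconnectedSpace (interior (μ.support \ irregularSet μ π)) :=
    isPreconnected_iff_preconnectedSpace.1 h_conn.isPreconnected
  have hM : EqOn (fun x => F₁ x - F₂ x) (fun _ => F₁ x₀ - F₂ x₀)
      (interior (μ.support \ irregularSet μ π)) := fun x hx =>
    hloc.apply_eq_of_preconnectedSpace ⟨x, hx⟩ ⟨x₀, hx₀⟩
  -- Regular points lie in `supp μ`, the closure of `M`, so continuity extends the equality.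
  refine hM.of_subset_closure ((continuousOn_of_potential hπ hc heq₁ hle₁).sub
    (continuousOn_of_potential hπ hc heq₂ hle₂)) continuousOn_const interior_subset ?_
  rw [h_closure]
  exact sdiff_subset

end Uniqueness

end KantorovichPotentials

theorem mainTheorem3 (d : ℕ) {X Y : Type*}
    [TopologicalSpace X] [T2Space X] [SecondCountableTopology X]
    [ChartedSpace (EuclideanSpace ℝ (Fin d)) X] [IsManifold (𝓡 d) ∞ X]
    [MeasurableSpace X] [BorelSpace X]
    [TopologicalSpace Y] [PolishSpace Y] [MeasurableSpace Y] [BorelSpace Y]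
    (μ : Measure X) [IsProbabilityMeasure μ] (ν : Measure Y) [IsProbabilityMeasure ν]
    (c : X × Y → ℝ) (hc_nonneg : ∀ z, 0 ≤ c z) (hc_cont : Continuous c)
    (hc_lip : KantorovichPotentials.LocallyLipschitzLocallyUniformly d c)
    (h_finite : KantorovichPotentials.transportCost c μ ν < ⊤)
    (π : Measure (X × Y)) (hπ : KantorovichPotentials.IsOptimalPlan c μ ν π)
    (h_mass : μ (μ.support \ KantorovichPotentials.irregularSet μ π) = 1)
    (h_conn : IsConnected (interior (μ.support \ KantorovichPotentials.irregularSet μ π)))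
    (h_closure :
      closure (interior (μ.support \ KantorovichPotentials.irregularSet μ π)) = μ.support)
    (h_grad : KantorovichPotentials.HasFullLebesgueMeasureInCharts d
      (interior (μ.support \ KantorovichPotentials.irregularSet μ π))
      (Prod.fst '' KantorovichPotentials.gradientSet d c π)) :
    KantorovichPotentials.AlmostSurelyUniquePotentials c μ ν := by
  intro f₁ f₂ hf₁ hf₂
  obtain ⟨F₁, G₁, hF₁, heq₁, hle₁⟩ := hf₁.exists_real hc_nonneg hc_cont h_finite hπ
  obtain ⟨F₂, G₂, hF₂, heq₂, hle₂⟩ := hf₂.exists_real hc_nonneg hc_cont h_finite hπ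
  have : IsManifold (𝓡 d) 1 X := IsManifold.of_le (n := ∞) (by simp)
  obtain ⟨a, ha⟩ := KantorovichPotentials.exists_sub_eq_const hπ.1.1 hc_lip heq₁ hle₁ heq₂ hle₂
    h_conn h_closure h_grad
  refine ⟨a, ?_⟩
  have hae : ∀ᵐ x ∂μ, x ∈ μ.support \ KantorovichPotentials.irregularSet μ π := by
    rw [ae_iff]
    exact (prob_compl_eq_zero_iff
      (KantorovichPotentials.measurableSet_support_diff_irregularSet μ π)).2 h_mass
  filter_upwards [hae] with x hx
  have hx' := KantorovichPotentials.mem_fst_image_support_of_mem_diff_irregularSet hπ.1.1 hx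
  rw [hF₁ x hx', hF₂ x hx', ← EReal.coe_sub, ha x hx]
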